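/- For $m\in\mathbb N$, $r>0$ and $x\in\mathbb R^m$ let $\|x\|_r=\big(\sum_{i=1}^m|x_i|^r\big)^{1/r}$, and write $\ell_r^m$ for $\mathbb R^m$ equipped with this (quasi-)norm. Let $0<p\le 1$, $p<q\le 2$, $\lambda>0$, and $\sigma_j=j^{-\lambda}$ for $j\in\mathbb N$. Let $$\mathcal E_{p,\sigma}^m=\Big\{x\in\mathbb R^m:\ \sum_{i=1}^m\frac{|x_i|^p}{\sigma_i^p}\le 1\Big\},$$ let $G_{n,m}$ be an $n\times m$ random matrix with independent standard Gaussian entries, and let $E_n^{\mathrm{ran}}=\ker G_{n,m}\subset\mathbb R^m$ (almost surely a subspace of codimension $n$ if $n\le m$). For a subspace $E\subset\mathbb R^m$ put $$\mathrm{rad}_{\ell_q^m}(\mathcal E_{p,\sigma}^m,E)=\sup_{x\in\mathcal E_{p,\sigma}^m\cap E}\|x\|_q .$$ Let $D_\sigma:\ell_p^m\to\ell_q^m$, $D_\sigma x=(\sigma_1x_1,\dots,\sigma_mx_m)$, be the diagonal operator, and for $1\le n<m$ let $$c_{n+1}(D_\sigma:\ell_p^m\to\ell_q^m)=\inf_{E}\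 \sup\{\|D_\sigma x\|_q:\ x\in E,\ \|x\|_p\le 1\}$$ be its $(n+1)$-st Gelfand number, where the infimum is over all linear subspaces $E\subset\mathbb R^m$ of codimension $n$. Then there exist constants $c,C,D>0$, depending only on $p$, $q$ and $\lambda$, such that for all $m\in\mathbb N$ and all $1\le n<m$ with $n\ge D\log(\mathrm e m/n)$ the following hold. 1. With probability at least $1-2\exp(-cn)$, $$\mathrm{rad}_{\ell_q^m}(\mathcal E_{p,\sigma}^m,E_n^{\mathrm{ran}})\le C\Big(\frac{\log(\mathrm e m/n)}{n}\Big)^{\lambda+1/p-1/q}.$$ 2. $$c_{n+1}(D_\sigma:\ell_p^m\to\ell_q^m)\le C\Big(\frac{\log(\mathrm e m/n)}{n}\Big)^{\lambda+1/p-1/q}.$$ (The admissible case $q=2$ is the one of the Euclidean radius.) -/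

import Mathlib

open MeasureTheory ProbabilityTheory
open scoped ENNReal

noncomputable section

namespace EllipsoidSections

/-- The `ℓ_q`-(quasi-)norm `(∑ |x_i|^q)^(1/q)` on `ℝ^m`, for `0 < q < ∞`. -/
def lqNorm {m : ℕ} (q : ℝ) (x : Fin m → ℝ) : ℝ :=
  (∑ i, |x i| ^ q) ^ (1 / q)

/-- The closed unit ball of `ℓ_p^m`. -/
def lpBall (m : ℕ) (p : ℝ) : Set (Fin m → ℝ) :=
  {x | lqNorm p x ≤ 1}

/-- The `ℓ_p`-ellipsoid in `ℝ^m` with semiaxes of length `σ_i`, for `0 < p < ∞`. -/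
def lpEllipsoid {m : ℕ} (p : ℝ) (σ : Fin m → ℝ) : Set (Fin m → ℝ) :=
  {x | ∑ i, |x i| ^ p / σ i ^ p ≤ 1}

/-- The semiaxes `σ_j = j^(-lam)` for `j = 1, …, m`; the index `i : Fin m` stands for `j = i + 1`. -/
def polySemiaxes (m : ℕ) (lam : ℝ) (i : Fin m) : ℝ :=
  ((i : ℝ) + 1) ^ (-lam)

/-- The `ℓ_q`-radius `sup {‖x‖_q : x ∈ K ∩ E}` of the section of `K` with the subspace `E`. -/
def sectionRadius {m : ℕ} (q : ℝ) (K : Set (Fin m → ℝ)) (E : Submodule ℝ (Fin m → ℝ)) : ℝ≥0∞ :=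
  ⨆ x ∈ K ∩ (E : Set (Fin m → ℝ)), ENNReal.ofReal (lqNorm q x)

/-- The law of an `n × m` matrix with independent standard Gaussian entries,
as a measure on the arrays `(A i j)` of its entries. -/
def gaussianMatrix (n m : ℕ) : Measure (Fin n → Fin m → ℝ) :=
  Measure.pi fun _ : Fin n => Measure.pi fun _ : Fin m => gaussianReal 0 1

/-- The kernel of a matrix, as a subspace of `ℝ^m`. -/
def matrixKernel {n m : ℕ} (A : Matrix (Fin n) (Fin m) ℝ) : Submodule ℝ (Fin m → ℝ) :=
  LinearMap.ker (Matrix.toLin' A)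

/-- The diagonal operator `x ↦ (σ_i x_i)_i`. -/
def diagOp {m : ℕ} (σ : Fin m → ℝ) : (Fin m → ℝ) →ₗ[ℝ] (Fin m → ℝ) :=
  Matrix.toLin' (Matrix.diagonal σ)

/-- The `k`-th Gelfand number (`k ≥ 1`) of `S : ℓ_p^m → ℓ_q^l`: the infimum, over all subspaces `E`
of codimension `k - 1`, of the supremum of `‖S x‖_q` over the `x ∈ E` in the unit ball of `ℓ_p^m`.
By convention it is `0` if `k > m`, where there is no such subspace. -/
def gelfandNumber {m l : ℕ} (k : ℕ) (p q : ℝ) (S : (Fin m → ℝ) →ₗ[ℝ] (Fin l → ℝ)) : ℝ≥0∞ :=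
  if m < k then 0 else
    ⨅ (E : Submodule ℝ (Fin m → ℝ)) (_ : Module.finrank ℝ ((Fin m → ℝ) ⧸ E) + 1 = k),
      ⨆ x ∈ lpBall m p ∩ (E : Set (Fin m → ℝ)), ENNReal.ofReal (lqNorm q (S x))

end EllipsoidSections

end

/-! A Gaussian matrix is well conditioned on sparse vectors, and a well-conditioned kernel meets the
ellipsoid only in small vectors. Take `s` of order `n / log(em/n)`.

Probability: for a fixed `z` the squared norm of `Az` is `‖z‖²` times a chi-square variable with `n`
degrees of freedom, so it lies between `n‖z‖²/16` and `16n‖z‖²` except with probability `2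
exp(-n/2)` (`gaussianMatrix_distortion`). Integer points of squared norm at most `4096 * (2 * s)`
serve as a net. There are at most `exp(n/4)` of them (`card_latticeBall_le_exp`), so a union bound
covers them all. Rounding a `2s`-sparse vector to a multiple of such a point keeps the support and
leaves a relative error of 1/64, which carries both bounds to all `2s`-sparse vectors
(`sparse_upper_of_lattice`, `sparse_lower_of_lattice`).

Geometry: let `x` lie in the ellipsoid and in the kernel. The head of `x` is its first `s`
coordinates together with the `s` largest later ones. Since the semiaxes decay, every entry outside
the head is at most `M = s^(-(lam+1/p))`, and these entries have `ℓ_1` norm at most `sM`. Cutting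
them into blocks of decreasing size bounds the image of the tail by a multiple of `√n √s M`. The
head has the opposite image, so its Euclidean norm is at most a multiple of `√s M`. Comparing `ℓ_q`
with `ℓ_2` on `2s` coordinates gives `s^(1/q) M` up to a constant (`lqNorm_le_of_sparse_bounds`).

The Gelfand bound follows by fixing one good matrix and pulling its kernel back through the diagonal
operator. -/

/-! ### Gaussian concentration for a fixed vector -/

/-- A unit linear combination of independent standard Gaussians is a standard Gaussian. -/
theorem gaussian_pi_map_dot {m : ℕ} (u : Fin m → ℝ) (hu : ∑ j, u j ^ 2 = 1) :
    (Measure.pi fun _ : Fin m => gaussianReal 0 1).map (fun g => ∑ j, g j * u j)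
      = gaussianReal 0 1 := by
  have hm : Measurable (fun g : Fin m → ℝ => ∑ j, g j * u j) := by fun_prop
  have : IsProbabilityMeasure
      ((Measure.pi fun _ : Fin m => gaussianReal 0 1).map (fun g => ∑ j, g j * u j)) :=
    Measure.isProbabilityMeasure_map hm.aemeasurable
  refine Measure.ext_of_charFun ?_
  ext t
  rw [charFun_apply_real, integral_map hm.aemeasurable (by fun_prop)]
  have h1 : ∀ g : Fin m → ℝ, Complex.exp (t * ((∑ j, g j * u j : ℝ) : ℂ) * Complex.I)
      = ∏ j, Complex.exp (((t * u j : ℝ) : ℂ) * g j * Complex.I) := by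
    intro g
    rw [← Complex.exp_sum]
    congr 1
    push_cast
    rw [Finset.mul_sum, Finset.sum_mul]
    exact Finset.sum_congr rfl fun j _ => by ring
  simp_rw [h1]
  rw [integral_fintype_prod_eq_prod
    (f := fun j (x : ℝ) => Complex.exp (((t * u j : ℝ) : ℂ) * x * Complex.I))]
  simp_rw [← charFun_apply_real, charFun_gaussianReal]
  rw [← Complex.exp_sum]
  congr 1
  have h2 : ((∑ j, u j ^ 2 : ℝ) : ℂ) = 1 := by rw [hu]; simp
  push_cast at h2 ⊢
  simp only [mul_zero, zero_mul, zero_sub, Finset.sum_neg_distrib, one_mul]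
  rw [← Finset.sum_div]
  simp_rw [mul_pow]
  rw [← Finset.mul_sum, h2, mul_one]

/-- The rows are independent, so the one-row statement tensorizes; this reduces the distortion of a
fixed vector to chi-square tails. -/
theorem gaussianMatrix_map_mulVec {n m : ℕ} (u : Fin m → ℝ) (hu : ∑ j, u j ^ 2 = 1) :
    (EllipsoidSections.gaussianMatrix n m).map (fun A i => ∑ j, A i j * u j)
      = Measure.pi fun _ : Fin n => gaussianReal 0 1 := by
  have hm : Measurable (fun g : Fin m → ℝ => ∑ j, g j * u j) := by fun_prop
  have hp := gaussian_pi_map_dot u hu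
  have : ∀ i : Fin n, SigmaFinite
      ((Measure.pi fun _ : Fin m => gaussianReal 0 1).map (fun g => ∑ j, g j * u j)) := by
    intro i; rw [hp]; infer_instance
  have h := Measure.pi_map_pi (ι := Fin n) (μ := fun _ => Measure.pi fun _ : Fin m => gaussianReal 0 1)
    (f := fun _ g => ∑ j, g j * u j) (fun _ => hm.aemeasurable)
  simp only [hp] at h
  exact h

theorem gaussianReal_exp_sq {t : ℝ} (ht : t < 1 / 2) :
    Integrable (fun x : ℝ => Real.exp (t * x ^ 2)) (gaussianReal 0 1) ∧
      ∫ x, Real.exp (t * x ^ 2) ∂(gaussianReal 0 1) = (√(1 - 2 * t))⁻¹ := by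
  have hb : 0 < 1 / 2 - t := by linarith
  have key : ∀ x : ℝ, gaussianPDFReal 0 1 x * Real.exp (t * x ^ 2)
      = (√(2 * Real.pi))⁻¹ * Real.exp (-(1 / 2 - t) * x ^ 2) := by
    intro x
    rw [gaussianPDFReal]
    simp only [NNReal.coe_one, mul_one, sub_zero]
    rw [mul_assoc, ← Real.exp_add]
    congr 2; ring
  constructor
  · rw [gaussianReal_of_var_ne_zero 0 one_ne_zero]
    rw [integrable_withDensity_iff (measurable_gaussianPDF 0 1)
      (ae_of_all _ fun x => gaussianPDF_lt_top)]
    simp only [toReal_gaussianPDF]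
    simp_rw [mul_comm _ (gaussianPDFReal _ _ _), key]
    exact (integrable_exp_neg_mul_sq hb).const_mul _
  · rw [integral_gaussianReal_eq_integral_smul one_ne_zero]
    simp_rw [smul_eq_mul, key]
    rw [integral_const_mul, integral_gaussian, ← Real.sqrt_inv, ← Real.sqrt_inv,
      ← Real.sqrt_mul (by positivity)]
    congr 1
    have : 1 - 2 * t ≠ 0 := by linarith
    have : 1 / 2 - t ≠ 0 := hb.ne'
    have := Real.pi_ne_zero
    field_simp

theorem gaussian_pi_exp_sum_sq (n : ℕ) {t : ℝ} (ht : t < 1 / 2) :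
    Integrable (fun y : Fin n → ℝ => Real.exp (t * ∑ i, y i ^ 2))
        (Measure.pi fun _ : Fin n => gaussianReal 0 1) ∧
      mgf (fun y : Fin n → ℝ => ∑ i, y i ^ 2) (Measure.pi fun _ : Fin n => gaussianReal 0 1) t
        = (√(1 - 2 * t))⁻¹ ^ n := by
  obtain ⟨h1, h2⟩ := gaussianReal_exp_sq ht
  have h3 : ∀ y : Fin n → ℝ, Real.exp (t * ∑ i, y i ^ 2) = ∏ i, Real.exp (t * y i ^ 2) := by
    intro y; rw [Finset.mul_sum, Real.exp_sum]
  constructor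
  · simp_rw [h3]
    exact Integrable.fintype_prod (f := fun _ x => Real.exp (t * x ^ 2)) fun _ => h1
  · rw [mgf]
    simp_rw [h3]
    rw [integral_fintype_prod_eq_prod (f := fun _ (x : ℝ) => Real.exp (t * x ^ 2))]
    simp [h2]

theorem gaussian_pi_upper_tail (n : ℕ) :
    (Measure.pi fun _ : Fin n => gaussianReal 0 1).real {y | 16 * (n : ℝ) ≤ ∑ i, y i ^ 2}
      ≤ Real.exp (-(n / 2)) := by
  obtain ⟨h1, h2⟩ := gaussian_pi_exp_sum_sq n (t := 1 / 4) (by norm_num)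
  refine (measure_ge_le_exp_mul_mgf (16 * (n : ℝ)) (by norm_num) h1).trans ?_
  rw [h2]
  -- Chernoff bound at `t = 1/4`: each coordinate contributes at most `e`, against `exp(-4)` per
  -- coordinate from the threshold.
  have h4 : (√(1 - 2 * (1 / 4)))⁻¹ ≤ Real.exp 1 := by
    have : (√(1 - 2 * (1 / 4)) : ℝ)⁻¹ ≤ 2 := by
      rw [inv_le_comm₀ (by apply Real.sqrt_pos.2; norm_num) (by norm_num)]
      apply Real.le_sqrt_of_sq_le; norm_num
    have := Real.add_one_le_exp (1 : ℝ)
    linarith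
  calc Real.exp (-(1 / 4) * (16 * n)) * (√(1 - 2 * (1 / 4)))⁻¹ ^ n
      ≤ Real.exp (-(1 / 4) * (16 * n)) * Real.exp 1 ^ n := by gcongr
    _ = Real.exp (-(3 * n)) := by
      rw [← Real.exp_nat_mul, ← Real.exp_add]; congr 1; ring
    _ ≤ Real.exp (-(n / 2)) := by
      apply Real.exp_le_exp.2
      have : (0 : ℝ) ≤ n := by positivity
      linarith

theorem gaussian_pi_lower_tail (n : ℕ) :
    (Measure.pi fun _ : Fin n => gaussianReal 0 1).real {y | ∑ i, y i ^ 2 ≤ (n : ℝ) / 16}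
      ≤ Real.exp (-(n / 2)) := by
  obtain ⟨h1, h2⟩ := gaussian_pi_exp_sum_sq n (t := -16) (by norm_num)
  refine (measure_le_le_exp_mul_mgf ((n : ℝ) / 16) (by norm_num) h1).trans ?_
  rw [h2]
  -- Chernoff bound at `t = -16`: `e^3 ≤ 27 ≤ 33` gives a factor `exp(-3/2)` per coordinate, and the
  -- threshold costs only `exp(1)`.
  have h4 : (√(1 - 2 * (-16)) : ℝ)⁻¹ ≤ Real.exp (-(3 / 2)) := by
    rw [Real.exp_neg]
    apply inv_anti₀ (Real.exp_pos _)
    apply Real.le_sqrt_of_sq_le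
    rw [← Real.exp_nat_mul]
    have : Real.exp ((2 : ℕ) * (3 / 2)) = Real.exp 1 ^ 3 := by
      rw [← Real.exp_nat_mul]; norm_num
    rw [this]
    calc Real.exp 1 ^ 3 ≤ 3 ^ 3 := by gcongr; exact Real.exp_one_lt_three.le
      _ ≤ _ := by norm_num
  calc Real.exp (-(-16) * (n / 16)) * (√(1 - 2 * (-16)))⁻¹ ^ n
      ≤ Real.exp (-(-16) * (n / 16)) * Real.exp (-(3 / 2)) ^ n := by gcongr
    _ = Real.exp (-(n / 2)) := by
      rw [← Real.exp_nat_mul, ← Real.exp_add]; congr 1; ring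

instance (n m : ℕ) : IsProbabilityMeasure (EllipsoidSections.gaussianMatrix n m) := by
  unfold EllipsoidSections.gaussianMatrix; infer_instance

/-- The Gaussian matrix distorts the Euclidean norm of a fixed vector by a bounded factor,
up to an exponentially small probability. -/
theorem gaussianMatrix_distortion {n m : ℕ} (z : Fin m → ℝ) :
    (EllipsoidSections.gaussianMatrix n m).real
      {A | ¬ ((n : ℝ) / 16 * ∑ j, z j ^ 2 ≤ ∑ i, (∑ j, A i j * z j) ^ 2 ∧
        ∑ i, (∑ j, A i j * z j) ^ 2 ≤ 16 * (n : ℝ) * ∑ j, z j ^ 2)}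
      ≤ 2 * Real.exp (-(n / 2)) := by
  by_cases hz : ∑ j, z j ^ 2 = 0
  · have hz0 : ∀ j, z j = 0 := by
      intro j
      have := (Finset.sum_eq_zero_iff_of_nonneg (fun j _ => sq_nonneg (z j))).1 hz j (Finset.mem_univ _)
      simpa using this
    simp [hz0]
    positivity
  have hpos : 0 < ∑ j, z j ^ 2 :=
    lt_of_le_of_ne (Finset.sum_nonneg fun j _ => sq_nonneg (z j)) (Ne.symm hz)
  set r := √(∑ j, z j ^ 2) with hr
  have hr0 : 0 < r := Real.sqrt_pos.2 hpos
  have hr2 : r ^ 2 = ∑ j, z j ^ 2 := Real.sq_sqrt hpos.le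
  set u : Fin m → ℝ := fun j => z j / r with hu
  have hu1 : ∑ j, u j ^ 2 = 1 := by
    simp_rw [hu, div_pow]
    rw [← Finset.sum_div, hr2, div_self hz]
  have hmap := gaussianMatrix_map_mulVec (n := n) u hu1
  have hmeas : Measurable (fun (A : Fin n → Fin m → ℝ) i => ∑ j, A i j * u j) := by fun_prop
  have hscale : ∀ A : Fin n → Fin m → ℝ,
      ∑ i, (∑ j, A i j * z j) ^ 2 = r ^ 2 * ∑ i, (∑ j, A i j * u j) ^ 2 := by
    intro A
    rw [Finset.mul_sum]
    refine Finset.sum_congr rfl fun i _ => ?_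
    rw [← mul_pow, Finset.mul_sum]
    congr 1
    refine Finset.sum_congr rfl fun j _ => ?_
    simp only [hu]; field_simp
  have hsub : {A : Fin n → Fin m → ℝ | ¬ ((n : ℝ) / 16 * ∑ j, z j ^ 2 ≤ ∑ i, (∑ j, A i j * z j) ^ 2 ∧
        ∑ i, (∑ j, A i j * z j) ^ 2 ≤ 16 * (n : ℝ) * ∑ j, z j ^ 2)} ⊆
      (fun (A : Fin n → Fin m → ℝ) i => ∑ j, A i j * u j) ⁻¹'
        ({y | 16 * (n : ℝ) ≤ ∑ i, y i ^ 2} ∪ {y | ∑ i, y i ^ 2 ≤ (n : ℝ) / 16}) := by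
    intro A hA
    simp only [Set.mem_ofPred_eq, Set.mem_preimage, Set.mem_union] at hA ⊢
    rw [hscale, ← hr2] at hA
    by_contra hcon
    push Not at hcon
    apply hA
    have hr2p : 0 < r ^ 2 := by positivity
    constructor
    · rw [mul_comm]; exact (mul_le_mul_of_nonneg_left hcon.2.le hr2p.le)
    · rw [mul_comm (16 * (n : ℝ))]; exact (mul_le_mul_of_nonneg_left hcon.1.le hr2p.le)
  have hms : MeasurableSet ({y : Fin n → ℝ | 16 * (n : ℝ) ≤ ∑ i, y i ^ 2} ∪
      {y | ∑ i, y i ^ 2 ≤ (n : ℝ) / 16}) :=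
    (measurableSet_le measurable_const (by fun_prop)).union
      (measurableSet_le (by fun_prop) measurable_const)
  refine (measureReal_mono hsub).trans ?_
  rw [← map_measureReal_apply hmeas hms, hmap]
  refine (measureReal_union_le _ _).trans ?_
  have := gaussian_pi_upper_tail n
  have := gaussian_pi_lower_tail n
  linarith

/-! ### Counting integer points in Euclidean balls -/

/-- A two-sided geometric series. The subtracted term makes the induction close, since `2t^(N+1) ≤
4t^(N+1) - 4t^(N+2)` for `t ≤ 1/2`. -/
theorem sum_Icc_pow_natAbs_le {t : ℝ} (ht0 : 0 ≤ t) (ht : t ≤ 1 / 2) (N : ℕ) :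
    ∑ z ∈ Finset.Icc (-(N : ℤ)) N, t ^ z.natAbs ≤ 1 + 4 * t - 4 * t ^ (N + 1) := by
  induction N with
  | zero => simp
  | succ N ih =>
    have h : Finset.Icc (-((N + 1 : ℕ) : ℤ)) ((N + 1 : ℕ) : ℤ)
        = insert (((N + 1 : ℕ) : ℤ)) (insert (-((N + 1 : ℕ) : ℤ)) (Finset.Icc (-(N : ℤ)) N)) := by
      ext z; simp only [Finset.mem_Icc, Finset.mem_insert]; omega
    rw [h, Finset.sum_insert, Finset.sum_insert, Int.natAbs_neg, Int.natAbs_natCast]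
    · have : t ^ (N + 1 + 1) ≤ t ^ (N + 1) * (1 / 2) := by
        rw [pow_succ]; gcongr
      linarith
    · simp only [Finset.mem_Icc]; omega
    · simp only [Finset.mem_Icc, Finset.mem_insert]; omega

/-- The integer points of `ℤ^m` with squared Euclidean norm at most `N`. -/
noncomputable def latticeBall (m N : ℕ) : Finset (Fin m → ℤ) :=
  (Fintype.piFinset fun _ : Fin m => Finset.Icc (-(N : ℤ)) N).filter fun z => ∑ i, z i ^ 2 ≤ N

theorem mem_latticeBall {m N : ℕ} {z : Fin m → ℤ} : z ∈ latticeBall m N ↔ ∑ i, z i ^ 2 ≤ N := by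
  simp only [latticeBall, Finset.mem_filter, Fintype.mem_piFinset, Finset.mem_Icc,
    and_iff_right_iff_imp]
  intro h i
  have h1 : z i ^ 2 ≤ N :=
    (Finset.single_le_sum (f := fun i => z i ^ 2) (fun j _ => sq_nonneg (z j))
      (Finset.mem_univ i)).trans h
  constructor <;> nlinarith

/-- A generating function bound for the number of integer points in a Euclidean ball. -/
theorem card_latticeBall_le {t : ℝ} (ht0 : 0 < t) (ht : t ≤ 1 / 2) (m N : ℕ) :
    ((latticeBall m N).card : ℝ) ≤ (t ^ N)⁻¹ * Real.exp (4 * t * m) := by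
  have h1 : ((latticeBall m N).card : ℝ) * t ^ N ≤ Real.exp (4 * t * m) := by
    calc ((latticeBall m N).card : ℝ) * t ^ N
        = ∑ z ∈ latticeBall m N, t ^ N := by rw [Finset.sum_const, nsmul_eq_mul]
      _ ≤ ∑ z ∈ latticeBall m N, ∏ i, t ^ (z i).natAbs := by
          refine Finset.sum_le_sum fun z hz => ?_
          rw [Finset.prod_pow_eq_pow_sum]
          refine pow_le_pow_of_le_one ht0.le (by linarith) ?_
          have h := mem_latticeBall.1 hz
          have : ∀ i, ((z i).natAbs : ℤ) ≤ z i ^ 2 := by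
            intro i
            rw [← Int.natAbs_sq]
            exact_mod_cast Nat.le_self_pow two_ne_zero _
          have h2 : ((∑ i, (z i).natAbs : ℕ) : ℤ) ≤ N := by
            push_cast
            refine (Finset.sum_le_sum fun i _ => ?_).trans h
            simpa using this i
          exact_mod_cast h2
      _ ≤ ∑ z ∈ Fintype.piFinset fun _ : Fin m => Finset.Icc (-(N : ℤ)) N,
            ∏ i, t ^ (z i).natAbs :=
          Finset.sum_le_sum_of_subset_of_nonneg (Finset.filter_subset _ _)
            fun _ _ _ => by positivity
      _ = (∑ z ∈ Finset.Icc (-(N : ℤ)) N, t ^ z.natAbs) ^ m := by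
          rw [← Finset.prod_univ_sum (fun _ : Fin m => Finset.Icc (-(N : ℤ)) N)
            (fun _ z => t ^ z.natAbs)]
          simp
      _ ≤ Real.exp (4 * t) ^ m := by
          refine pow_le_pow_left₀ (Finset.sum_nonneg fun _ _ => by positivity) ?_ m
          have := sum_Icc_pow_natAbs_le ht0.le ht N
          have := Real.add_one_le_exp (4 * t)
          have : 0 < t ^ (N + 1) := by positivity
          linarith
      _ = Real.exp (4 * t * m) := by rw [← Real.exp_nat_mul]; congr 1; ring
  have : 0 < t ^ N := by positivity
  rw [inv_mul_eq_div, le_div_iff₀ this]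
  exact h1

/-- The logarithm of the number of integer points in a ball of squared radius
`N ≤ n / (64 log (em/n))` is at most `n / 4`. -/
theorem card_latticeBall_le_exp {m n N : ℕ} (hn : 1 ≤ n) (hnm : n < m)
    (hN : (N : ℝ) * Real.log (Real.exp 1 * m / n) ≤ n / 64) :
    ((latticeBall m N).card : ℝ) ≤ Real.exp (n / 4) := by
  have hn0 : (0 : ℝ) < n := by exact_mod_cast hn
  have hnm' : (n : ℝ) < m := by exact_mod_cast hnm
  have hm0 : (0 : ℝ) < m := hn0.trans hnm'
  -- With this `t` the exponential factor is `exp(n/16)`, and `t^(-N)` is at most `exp(6 N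
  -- log(em/n)) ≤ exp(6n/64)`.
  set t : ℝ := n / (64 * m) with ht
  have ht0 : 0 < t := by positivity
  have ht1 : t ≤ 1 / 2 := by
    rw [ht, div_le_iff₀ (by positivity)]; linarith
  refine (card_latticeBall_le ht0 ht1 m N).trans ?_
  set l := Real.log (Real.exp 1 * m / n) with hl
  have hl' : l = 1 + Real.log (m / n) := by
    rw [hl, mul_div_assoc, Real.log_mul (Real.exp_ne_zero _) (by positivity), Real.log_exp]
  have hlog : 0 ≤ Real.log (m / n) := Real.log_nonneg (by rw [le_div_iff₀ hn0]; linarith)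
  have h64 : Real.log 64 ≤ 6 := by
    have : (64 : ℝ) = 2 ^ 6 := by norm_num
    rw [this, Real.log_pow]
    have := Real.log_two_lt_d9
    push_cast; linarith
  have hinv : (t ^ N)⁻¹ = Real.exp (N * (Real.log 64 + Real.log (m / n))) := by
    rw [← Real.log_mul (by norm_num) (by positivity), Real.exp_nat_mul,
      Real.exp_log (by positivity), ← inv_pow]
    congr 1; rw [ht]; field_simp
  rw [hinv, ← Real.exp_add]
  apply Real.exp_le_exp.2
  have h4 : 4 * t * m = n / 16 := by rw [ht]; field_simp; ring
  rw [h4]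
  have : (N : ℝ) * (Real.log 64 + Real.log (m / n)) ≤ 6 * (N * l) := by
    have hN0 : (0 : ℝ) ≤ N := by positivity
    calc (N : ℝ) * (Real.log 64 + Real.log (m / n)) ≤ N * (6 * l) := by
          gcongr; rw [hl']; linarith
      _ = _ := by ring
  linarith

/-! ### Well-conditioning: from integer points to sparse vectors -/

theorem exists_int_trunc (y : ℝ) : ∃ z : ℤ, |(z : ℝ)| ≤ |y| ∧ |y - z| ≤ 1 := by
  rcases le_total 0 y with h | h
  · refine ⟨⌊y⌋, ?_, ?_⟩
    · have : (0 : ℝ) ≤ ⌊y⌋ := by exact_mod_cast Int.floor_nonneg.2 h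
      rw [abs_of_nonneg h, abs_of_nonneg this]; exact Int.floor_le y
    · rw [abs_le]; constructor <;> linarith [Int.floor_le y, Int.lt_floor_add_one y]
  · refine ⟨⌈y⌉, ?_, ?_⟩
    · have : (⌈y⌉ : ℝ) ≤ 0 := by exact_mod_cast Int.ceil_le.2 (by simpa using h)
      rw [abs_of_nonpos h, abs_of_nonpos this]; linarith [Int.le_ceil y]
    · rw [abs_le]; constructor <;> linarith [Int.le_ceil y, Int.ceil_lt_add_one y]

/-- The restriction of a vector to the coordinates in `S`. -/
noncomputable def coordRestrict {m : ℕ} (S : Finset (Fin m)) (x : Fin m → ℝ) :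
    EuclideanSpace ℝ (Fin m) :=
  WithLp.toLp 2 fun i => if i ∈ S then x i else 0

theorem norm_sq_coordRestrict {m : ℕ} (S : Finset (Fin m)) (x : Fin m → ℝ) :
    ‖coordRestrict S x‖ ^ 2 = ∑ i ∈ S, x i ^ 2 := by
  rw [EuclideanSpace.real_norm_sq_eq]
  simp [coordRestrict, ite_pow, Finset.sum_ite_mem]

theorem coordRestrict_union {m : ℕ} {S U : Finset (Fin m)} (h : Disjoint S U) (x : Fin m → ℝ) :
    coordRestrict (S ∪ U) x = coordRestrict S x + coordRestrict U x := by
  ext i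
  simp only [coordRestrict, PiLp.add_apply, Finset.mem_union]
  by_cases h1 : i ∈ S
  · have := Finset.disjoint_left.1 h h1; simp [h1, this]
  · simp [h1]

theorem coordRestrict_eq_self {m : ℕ} {S : Finset (Fin m)} {x : EuclideanSpace ℝ (Fin m)}
    (h : ∀ i ∉ S, x i = 0) : coordRestrict S x = x := by
  ext i
  by_cases h1 : i ∈ S
  · simp [coordRestrict, h1]
  · simp [coordRestrict, h1, h i h1]

/-- Rounding a sparse vector towards zero to a multiple of an integer vector. -/
theorem exists_lattice_approx {m k : ℕ} (hk : 1 ≤ k) {S : Finset (Fin m)} (hS : S.card ≤ k)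
    {x : EuclideanSpace ℝ (Fin m)} (hx : ∀ i ∉ S, x i = 0) :
    ∃ z ∈ latticeBall m (4096 * k), ∃ δ : ℝ, 0 ≤ δ ∧
      ‖x - δ • WithLp.toLp 2 (fun i => (z i : ℝ))‖ ≤ ‖x‖ / 64 ∧
      ‖δ • (WithLp.toLp 2 (fun i => (z i : ℝ)) : EuclideanSpace ℝ (Fin m))‖ ≤ ‖x‖ ∧
      ∀ i ∉ S, (x - δ • WithLp.toLp 2 (fun i => (z i : ℝ))) i = 0 := by
  by_cases hx0 : x = 0
  · refine ⟨0, ?_, 0, le_rfl, ?_, ?_, ?_⟩ <;> simp [hx0, mem_latticeBall]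
  have hr : 0 < ‖x‖ := norm_pos_iff.2 hx0
  have hk0 : (0 : ℝ) < k := by exact_mod_cast hk
  -- An error of at most `δ` on each of `k` coordinates totals `‖x‖/64`, and the integer point has
  -- squared norm at most `‖x‖²/δ² = 4096k`.
  set δ : ℝ := ‖x‖ / (64 * √k) with hδ
  have hδ0 : 0 < δ := by positivity
  have hδ2 : δ ^ 2 * (4096 * k) = ‖x‖ ^ 2 := by
    rw [hδ, div_pow, mul_pow, Real.sq_sqrt hk0.le]; field_simp; norm_num
  choose z hz1 hz2 using fun i => exists_int_trunc (x i / δ)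
  have hz1' : ∀ i, (δ * z i) ^ 2 ≤ x i ^ 2 := by
    intro i
    rw [sq_le_sq, abs_mul, abs_of_pos hδ0]
    have := hz1 i
    rw [abs_div, abs_of_pos hδ0, le_div_iff₀ hδ0] at this
    linarith
  have hz2' : ∀ i, (x i - δ * z i) ^ 2 ≤ δ ^ 2 := by
    intro i
    have h1 : x i - δ * z i = δ * (x i / δ - z i) := by field_simp
    rw [h1, mul_pow]
    have : (x i / δ - z i) ^ 2 ≤ 1 := by rw [sq_le_one_iff_abs_le_one]; exact hz2 i
    nlinarith [sq_nonneg δ]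
  have hoff : ∀ i ∉ S, (x - δ • (WithLp.toLp 2 (fun i => (z i : ℝ)) :
      EuclideanSpace ℝ (Fin m))) i = 0 := by
    intro i hi
    have h0 := hz1' i
    rw [hx i hi] at h0
    have : (δ * z i) ^ 2 = 0 := le_antisymm (by simpa using h0) (sq_nonneg _)
    simpa [hx i hi] using this
  have hnorm : ‖δ • (WithLp.toLp 2 (fun i => (z i : ℝ)) : EuclideanSpace ℝ (Fin m))‖ ≤ ‖x‖ := by
    rw [← sq_le_sq₀ (norm_nonneg _) (norm_nonneg _), EuclideanSpace.real_norm_sq_eq,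
      EuclideanSpace.real_norm_sq_eq]
    exact Finset.sum_le_sum fun i _ => by simpa using hz1' i
  refine ⟨z, ?_, δ, hδ0.le, ?_, hnorm, hoff⟩
  · rw [mem_latticeBall]
    have h1 : δ ^ 2 * ∑ i, (z i : ℝ) ^ 2 ≤ δ ^ 2 * (4096 * k) := by
      rw [hδ2, EuclideanSpace.real_norm_sq_eq, Finset.mul_sum]
      exact Finset.sum_le_sum fun i _ => by rw [← mul_pow]; exact hz1' i
    have h2 := le_of_mul_le_mul_left h1 (by positivity)
    exact_mod_cast h2
  · rw [← sq_le_sq₀ (norm_nonneg _) (by positivity), ← coordRestrict_eq_self hoff,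
      norm_sq_coordRestrict]
    calc ∑ i ∈ S, (x - δ • (WithLp.toLp 2 (fun i => (z i : ℝ)) :
            EuclideanSpace ℝ (Fin m))) i ^ 2 ≤ ∑ _i ∈ S, δ ^ 2 :=
          Finset.sum_le_sum fun i _ => by simpa using hz2' i
      _ = S.card * δ ^ 2 := by rw [Finset.sum_const, nsmul_eq_mul]
      _ ≤ k * δ ^ 2 := by gcongr
      _ = (‖x‖ / 64) ^ 2 := by
          have : (‖x‖ / 64) ^ 2 = ‖x‖ ^ 2 / 4096 := by ring
          linarith

section
variable {m : ℕ} {V : Type*} [NormedAddCommGroup V] [NormedSpace ℝ V]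

/-- An upper bound on the integer points of a ball carries over to all sparse vectors. -/
theorem sparse_upper_of_lattice {k : ℕ} (hk : 1 ≤ k)
    (T : EuclideanSpace ℝ (Fin m) →L[ℝ] V) {β : ℝ} (hβ : 0 ≤ β)
    (hT : ∀ z ∈ latticeBall m (4096 * k), ‖T (WithLp.toLp 2 (fun i => (z i : ℝ)))‖ ≤
      4 * β * ‖(WithLp.toLp 2 (fun i => (z i : ℝ)) : EuclideanSpace ℝ (Fin m))‖)
    {S : Finset (Fin m)} (hS : S.card ≤ k) {x : EuclideanSpace ℝ (Fin m)}
    (hx : ∀ i ∉ S, x i = 0) : ‖T x‖ ≤ 5 * β * ‖x‖ := by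
  -- `B` is the set of admissible operator bounds on vectors supported in `S`. Rounding maps `b` to
  -- `4β + b/64`, so the infimum is at most `(256/63)β < 5β`.
  set B : Set ℝ := {b | 0 ≤ b ∧ ∀ x : EuclideanSpace ℝ (Fin m), (∀ i ∉ S, x i = 0) →
    ‖T x‖ ≤ b * ‖x‖} with hB
  have hne : B.Nonempty := ⟨‖T‖, norm_nonneg _, fun x _ => T.le_opNorm x⟩
  have hbdd : BddBelow B := ⟨0, fun b hb => hb.1⟩
  have hstep : ∀ b ∈ B, 4 * β + b / 64 ∈ B := by
    intro b hb
    refine ⟨by have := hb.1; positivity, fun x hx => ?_⟩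
    obtain ⟨z, hz, δ, hδ, h1, h2, h3⟩ := exists_lattice_approx hk hS hx
    set v : EuclideanSpace ℝ (Fin m) := WithLp.toLp 2 (fun i => (z i : ℝ)) with hv
    have e1 : ‖T (δ • v)‖ ≤ 4 * β * ‖x‖ := by
      rw [map_smul, norm_smul]
      rw [norm_smul] at h2
      calc ‖δ‖ * ‖T v‖ ≤ ‖δ‖ * (4 * β * ‖v‖) := by gcongr; exact hT z hz
        _ = 4 * β * (‖δ‖ * ‖v‖) := by ring
        _ ≤ _ := by gcongr
    have e2 : ‖T (x - δ • v)‖ ≤ b * (‖x‖ / 64) :=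
      (hb.2 _ h3).trans (mul_le_mul_of_nonneg_left h1 hb.1)
    have e3 : T x = T (δ • v) + T (x - δ • v) := by rw [← map_add]; congr 1; abel
    rw [e3]
    refine (norm_add_le _ _).trans ?_
    linarith
  have hinf : sInf B ≤ 4 * β + sInf B / 64 := by
    have h : ∀ b ∈ B, 64 * (sInf B - 4 * β) ≤ b := by
      intro b hb
      have := csInf_le hbdd (hstep b hb)
      linarith
    have := le_csInf hne h
    linarith
  have hclosed : ∀ x : EuclideanSpace ℝ (Fin m), (∀ i ∉ S, x i = 0) → ‖T x‖ ≤ sInf B * ‖x‖ := by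
    intro x hx
    by_cases hx0 : ‖x‖ = 0
    · rw [norm_eq_zero.1 hx0]; simp
    have hpos : 0 < ‖x‖ := lt_of_le_of_ne (norm_nonneg _) (Ne.symm hx0)
    rw [← div_le_iff₀ hpos]
    exact le_csInf hne fun b hb => by rw [div_le_iff₀ hpos]; exact hb.2 x hx
  refine (hclosed x hx).trans ?_
  gcongr
  linarith

/-- A two-sided bound on the integer points of a ball gives a lower bound on all sparse vectors. -/
theorem sparse_lower_of_lattice {k : ℕ} (hk : 1 ≤ k)
    (T : EuclideanSpace ℝ (Fin m) →L[ℝ] V) {β : ℝ} (hβ : 0 ≤ β)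
    (hT : ∀ z ∈ latticeBall m (4096 * k), ‖T (WithLp.toLp 2 (fun i => (z i : ℝ)))‖ ≤
      4 * β * ‖(WithLp.toLp 2 (fun i => (z i : ℝ)) : EuclideanSpace ℝ (Fin m))‖)
    (hT' : ∀ z ∈ latticeBall m (4096 * k),
      β / 4 * ‖(WithLp.toLp 2 (fun i => (z i : ℝ)) : EuclideanSpace ℝ (Fin m))‖ ≤
      ‖T (WithLp.toLp 2 (fun i => (z i : ℝ)))‖)
    {S : Finset (Fin m)} (hS : S.card ≤ k) {x : EuclideanSpace ℝ (Fin m)}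
    (hx : ∀ i ∉ S, x i = 0) : β / 8 * ‖x‖ ≤ ‖T x‖ := by
  obtain ⟨z, hz, δ, hδ, h1, h2, h3⟩ := exists_lattice_approx hk hS hx
  set v : EuclideanSpace ℝ (Fin m) := WithLp.toLp 2 (fun i => (z i : ℝ)) with hv
  have e1 : β / 4 * ‖δ • v‖ ≤ ‖T (δ • v)‖ := by
    rw [map_smul, norm_smul, norm_smul]
    calc β / 4 * (‖δ‖ * ‖v‖) = ‖δ‖ * (β / 4 * ‖v‖) := by ring
      _ ≤ _ := by gcongr; exact hT' z hz
  have e2 := sparse_upper_of_lattice hk T hβ hT hS h3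
  have e3 : ‖x‖ ≤ ‖δ • v‖ + ‖x - δ • v‖ := by
    have := norm_add_le (δ • v) (x - δ • v); simpa using this
  have e4 : ‖T (δ • v)‖ ≤ ‖T x‖ + ‖T (x - δ • v)‖ := by
    have : T (δ • v) = T x - T (x - δ • v) := by rw [← map_sub]; congr 1; abel
    rw [this]; exact norm_sub_le _ _
  have e5 : β * ‖x - δ • v‖ ≤ β * (‖x‖ / 64) := by gcongr
  have e6 : β * ‖x‖ ≤ β * (‖δ • v‖ + ‖x - δ • v‖) := by gcongr
  have : 0 ≤ β * ‖x‖ := by positivity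
  -- The net point contributes at least `(1/4)(63/64)β‖x‖` and the rounding error costs at most
  -- `(5/64)β‖x‖`, leaving `(43/256)β‖x‖`.
  linarith

end

/-! ### Block decomposition and the radius of a kernel section -/

/-- Selection of the `s` largest values of a nonnegative function on a finite set. -/
theorem exists_largest_subset {ι : Type*} [DecidableEq ι] (S : Finset ι) (f : ι → ℝ)
    (hf : ∀ i, 0 ≤ f i) (s : ℕ) :
    ∃ U ⊆ S, ∃ μ : ℝ, 0 ≤ μ ∧ U.card ≤ s ∧ (∀ i ∈ S \ U, f i ≤ μ) ∧ (∀ i ∈ U, μ ≤ f i) ∧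
      (U.card = s ∨ U = S ∧ μ = 0) := by
  induction s with
  | zero =>
    -- With nothing selected, any upper bound of `f` on `S` can serve as threshold.
    refine ⟨∅, by simp, ∑ i ∈ S, f i, Finset.sum_nonneg fun i _ => hf i, by simp, ?_, by simp,
      by simp⟩
    intro i hi
    exact Finset.single_le_sum (fun j _ => hf j) (by simpa using hi)
  | succ s ih =>
    obtain ⟨U, hUS, μ, hμ, hc, h1, h2, h3⟩ := ih
    by_cases hU : U = S
    · refine ⟨U, hUS, 0, le_rfl, by omega, ?_, fun i _ => hf i, Or.inr ⟨hU, rfl⟩⟩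
      simp [hU]
    have hne : (S \ U).Nonempty := by
      rw [Finset.sdiff_nonempty]; exact fun h => hU (hUS.antisymm h)
    obtain ⟨i, hi, hmax⟩ := Finset.exists_max_image (S \ U) f hne
    have hi' := Finset.mem_sdiff.1 hi
    have hcard : U.card = s := h3.resolve_right fun h => hU h.1
    refine ⟨insert i U, Finset.insert_subset hi'.1 hUS, f i, hf i, ?_, ?_, ?_, Or.inl ?_⟩
    · rw [Finset.card_insert_of_notMem hi'.2]; omega
    · intro j hj
      apply hmax
      simp only [Finset.mem_sdiff, Finset.mem_insert, not_or] at hj ⊢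
      exact ⟨hj.1, hj.2.2⟩
    · intro j hj
      rcases Finset.mem_insert.1 hj with rfl | hj
      · exact le_rfl
      · exact (h1 i hi).trans (h2 j hj)
    · rw [Finset.card_insert_of_notMem hi'.2, hcard]

section
variable {m : ℕ} {V : Type*} [NormedAddCommGroup V] [NormedSpace ℝ V]

theorem norm_coordRestrict_le {s : ℕ} {U : Finset (Fin m)} (hU : U.card ≤ s) {x : Fin m → ℝ}
    {μ : ℝ} (hμ : 0 ≤ μ) (h : ∀ i ∈ U, |x i| ≤ μ) : ‖coordRestrict U x‖ ≤ √s * μ := by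
  rw [← sq_le_sq₀ (norm_nonneg _) (by positivity), norm_sq_coordRestrict, mul_pow,
    Real.sq_sqrt (by positivity)]
  calc ∑ i ∈ U, x i ^ 2 ≤ ∑ _i ∈ U, μ ^ 2 :=
        Finset.sum_le_sum fun i hi => by rw [← sq_abs]; gcongr; exact h i hi
    _ = U.card * μ ^ 2 := by rw [Finset.sum_const, nsmul_eq_mul]
    _ ≤ s * μ ^ 2 := by gcongr

/-- An operator bounded on `s`-sparse vectors is bounded by the `ℓ_∞` and `ℓ_1` norms. -/
theorem norm_apply_coordRestrict_le {s : ℕ} (hs : 1 ≤ s) (T : EuclideanSpace ℝ (Fin m) →L[ℝ] V)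
    {b : ℝ} (hb : 0 ≤ b)
    (hT : ∀ (U : Finset (Fin m)) (x : Fin m → ℝ), U.card ≤ s →
      ‖T (coordRestrict U x)‖ ≤ b * ‖coordRestrict U x‖)
    (x : Fin m → ℝ) (S : Finset (Fin m)) (μ : ℝ) (hμ : 0 ≤ μ) (hx : ∀ i ∈ S, |x i| ≤ μ) :
    ‖T (coordRestrict S x)‖ ≤ b * (√s * μ + (√s)⁻¹ * ∑ i ∈ S, |x i|) := by
  have hs0 : (0 : ℝ) < s := by exact_mod_cast hs
  have hsq : 0 < √(s : ℝ) := Real.sqrt_pos.2 hs0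
  induction hN : S.card using Nat.strong_induction_on generalizing S μ with
  | _ N ih =>
  obtain ⟨U, hUS, ν, hν, hc, h1, h2, h3⟩ :=
    exists_largest_subset S (fun i => |x i|) (fun i => abs_nonneg _) s
  have hU : ‖T (coordRestrict U x)‖ ≤ b * (√s * μ) :=
    (hT U x hc).trans (mul_le_mul_of_nonneg_left
      (norm_coordRestrict_le hc hμ fun i hi => hx i (hUS hi)) hb)
  rcases h3 with h3 | ⟨h3, -⟩
  · have hlt : (S \ U).card < N := by
      rw [Finset.card_sdiff_of_subset hUS]
      have := Finset.card_le_card hUS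
      omega
    have hrest := ih _ hlt (S \ U) ν hν h1 rfl
    -- All `s` entries of the removed block are at least `ν`, so its `ℓ_1` mass pays for the term
    -- `√s * ν` of the remaining blocks.
    have hsν : s * ν ≤ ∑ i ∈ U, |x i| := by
      rw [← h3, ← nsmul_eq_mul]
      exact Finset.card_nsmul_le_sum _ _ _ h2
    have hsplit : ∑ i ∈ S, |x i| = ∑ i ∈ S \ U, |x i| + ∑ i ∈ U, |x i| :=
      (Finset.sum_sdiff hUS).symm
    have hT' : T (coordRestrict S x) = T (coordRestrict U x) + T (coordRestrict (S \ U) x) := by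
      rw [← map_add, ← coordRestrict_union Finset.disjoint_sdiff, Finset.union_sdiff_of_subset hUS]
    have hν' : √s * ν ≤ (√s)⁻¹ * ∑ i ∈ U, |x i| := by
      rw [inv_mul_eq_div, le_div_iff₀ hsq]
      calc √s * ν * √s = (√s * √s) * ν := by ring
        _ = s * ν := by rw [Real.mul_self_sqrt hs0.le]
        _ ≤ _ := hsν
    rw [hT', hsplit]
    calc _ ≤ b * (√s * μ) + b * (√s * ν + (√s)⁻¹ * ∑ i ∈ S \ U, |x i|) :=
          (norm_add_le _ _).trans (add_le_add hU hrest)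
      _ ≤ b * (√s * μ) + b * ((√s)⁻¹ * ∑ i ∈ U, |x i| + (√s)⁻¹ * ∑ i ∈ S \ U, |x i|) := by
          gcongr
      _ = _ := by ring
  · subst h3
    refine hU.trans ?_
    gcongr
    exact le_add_of_nonneg_right (by positivity)

/-- Split at `y = A`. Summed over a small support, this replaces Hölder's inequality between `ℓ_q`
and `ℓ_2`. -/
theorem rpow_le_of_sq {q A y : ℝ} (hq0 : 0 ≤ q) (hq2 : q ≤ 2) (hA : 0 < A) (hy : 0 ≤ y) :
    y ^ q ≤ A ^ q + A ^ (q - 2) * y ^ 2 := by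
  rcases le_total y A with h | h
  · exact (Real.rpow_le_rpow hy h hq0).trans (le_add_of_nonneg_right (by positivity))
  · have hy0 : 0 < y := hA.trans_le h
    have h1 : y ^ q = y ^ (q - 2) * y ^ 2 := by
      rw [← Real.rpow_natCast, ← Real.rpow_add hy0]; norm_num
    have h2 : y ^ (q - 2) ≤ A ^ (q - 2) := Real.rpow_le_rpow_of_nonpos hA h (by linarith)
    rw [h1]
    exact (mul_le_mul_of_nonneg_right h2 (sq_nonneg y)).trans
      (le_add_of_nonneg_left (Real.rpow_nonneg hA.le q))

/-- Tail decay of an ellipsoid with polynomial semiaxes. -/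
theorem tail_sum_le {p lam : ℝ} (hp : 0 < p) (hlam : 0 < lam) {s : ℕ} (hs : 1 ≤ s)
    {x : Fin m → ℝ}
    (hx : x ∈ EllipsoidSections.lpEllipsoid p (EllipsoidSections.polySemiaxes m lam)) :
    ∑ i with s ≤ (i : Fin m).val, |x i| ^ p ≤ (s : ℝ) ^ (-(lam * p)) := by
  have hs0 : (0 : ℝ) < s := by exact_mod_cast hs
  have hx' : ∑ i, |x i| ^ p / EllipsoidSections.polySemiaxes m lam i ^ p ≤ 1 := hx
  have hpos : ∀ i : Fin m, 0 < EllipsoidSections.polySemiaxes m lam i := fun i => by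
    unfold EllipsoidSections.polySemiaxes; positivity
  have h1 : ∑ i with s ≤ (i : Fin m).val, |x i| ^ p ≤
      ∑ i with s ≤ (i : Fin m).val,
        (s : ℝ) ^ (-(lam * p)) * (|x i| ^ p / EllipsoidSections.polySemiaxes m lam i ^ p) := by
    refine Finset.sum_le_sum fun i hi => ?_
    have hi' : s ≤ i.val := (Finset.mem_filter.1 hi).2
    have hi'' : (s : ℝ) ≤ i.val := by exact_mod_cast hi'
    have h2 : EllipsoidSections.polySemiaxes m lam i ^ p ≤ (s : ℝ) ^ (-(lam * p)) := by
      unfold EllipsoidSections.polySemiaxes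
      rw [← Real.rpow_mul (by positivity), neg_mul]
      exact Real.rpow_le_rpow_of_nonpos hs0 (by linarith) (by nlinarith)
    have h3 := Real.rpow_pos_of_pos (hpos i) p
    rw [← mul_div_assoc, le_div_iff₀ h3, mul_comm]
    gcongr
  refine h1.trans ?_
  rw [← Finset.mul_sum]
  refine mul_le_of_le_one_right (by positivity) (le_trans ?_ hx')
  exact Finset.sum_le_sum_of_subset_of_nonneg (Finset.filter_subset _ _) fun i _ _ =>
    div_nonneg (by positivity) (Real.rpow_nonneg (hpos i).le p)

/-- The null space of an operator that is well conditioned on sparse vectors has sections of small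
radius with ellipsoids. -/
theorem lqNorm_le_of_sparse_bounds {p q lam : ℝ} (hp0 : 0 < p) (hp1 : p ≤ 1) (hpq : p < q)
    (hq2 : q ≤ 2) (hlam : 0 < lam) {s : ℕ} (hs : 1 ≤ s)
    (T : EuclideanSpace ℝ (Fin m) →L[ℝ] V) {β : ℝ} (hβ : 0 < β)
    (hup : ∀ (U : Finset (Fin m)) (x : Fin m → ℝ), U.card ≤ 2 * s →
      ‖T (coordRestrict U x)‖ ≤ 5 * β * ‖coordRestrict U x‖)
    (hlow : ∀ (U : Finset (Fin m)) (x : Fin m → ℝ), U.card ≤ 2 * s →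
      β / 8 * ‖coordRestrict U x‖ ≤ ‖T (coordRestrict U x)‖)
    {x : Fin m → ℝ}
    (hx : x ∈ EllipsoidSections.lpEllipsoid p (EllipsoidSections.polySemiaxes m lam))
    (hTx : T (WithLp.toLp 2 x) = 0) :
    EllipsoidSections.lqNorm q x ≤
      4 ^ (1 / q) * 80 * (s : ℝ) ^ (-(lam + 1 / p - 1 / q)) := by
  have hq0 : 0 < q := hp0.trans hpq
  have hs0 : (0 : ℝ) < s := by exact_mod_cast hs
  have hsq : 0 < √(s : ℝ) := Real.sqrt_pos.2 hs0
  set R : Finset (Fin m) := Finset.univ.filter fun i => s ≤ i.val with hR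
  -- `M` is the common size of `s` equal entries that exhaust the tail bound `s^(-(lam * p))`.
  set M : ℝ := (s : ℝ) ^ (-(lam + 1 / p)) with hM
  have hM0 : 0 < M := by positivity
  have hMp : s * M ^ p = (s : ℝ) ^ (-(lam * p)) := by
    rw [hM, ← Real.rpow_mul hs0.le]
    nth_rewrite 1 [← Real.rpow_one (s : ℝ)]
    rw [← Real.rpow_add hs0]
    congr 1; field_simp; ring
  have htail : ∑ i ∈ R, |x i| ^ p ≤ s * M ^ p := by
    rw [hMp]; exact tail_sum_le hp0 hlam hs hx
  obtain ⟨U, hUR, μ, hμ, hc, h1, h2, h3⟩ :=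
    exists_largest_subset R (fun i => |x i|) (fun i => abs_nonneg _) s
  have hμM : μ ≤ M := by
    rcases h3 with h3 | ⟨-, h3⟩
    · have h4 : s * μ ^ p ≤ s * M ^ p := by
        refine le_trans ?_ htail
        calc s * μ ^ p = ∑ _i ∈ U, μ ^ p := by rw [Finset.sum_const, h3, nsmul_eq_mul]
          _ ≤ ∑ i ∈ U, |x i| ^ p :=
            Finset.sum_le_sum fun i hi => Real.rpow_le_rpow hμ (h2 i hi) hp0.le
          _ ≤ _ := Finset.sum_le_sum_of_subset_of_nonneg hUR fun i _ _ => by positivity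
      have h5 := le_of_mul_le_mul_left h4 hs0
      exact (Real.rpow_le_rpow_iff hμ hM0.le hp0).1 h5
    · rw [h3]; exact hM0.le
  set S := R \ U with hS
  -- power sums over the tail `S`
  have hSr : ∀ r : ℝ, p ≤ r → ∑ i ∈ S, |x i| ^ r ≤ s * M ^ r := by
    intro r hr
    calc ∑ i ∈ S, |x i| ^ r ≤ ∑ i ∈ S, M ^ (r - p) * |x i| ^ p := by
          refine Finset.sum_le_sum fun i hi => ?_
          have e : |x i| ^ r = |x i| ^ (r - p) * |x i| ^ p := by
            rw [← Real.rpow_add_of_nonneg (abs_nonneg _) (by linarith) hp0.le]; simp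
          rw [e]
          exact mul_le_mul_of_nonneg_right (Real.rpow_le_rpow (abs_nonneg _)
            ((h1 i hi).trans hμM) (sub_nonneg.2 hr)) (Real.rpow_nonneg (abs_nonneg _) p)
      _ = M ^ (r - p) * ∑ i ∈ S, |x i| ^ p := by rw [Finset.mul_sum]
      _ ≤ M ^ (r - p) * (s * M ^ p) := by
          gcongr
          exact (Finset.sum_le_sum_of_subset_of_nonneg Finset.sdiff_subset
            fun i _ _ => by positivity).trans htail
      _ = s * (M ^ (r - p) * M ^ p) := by ring
      _ = s * M ^ r := by rw [← Real.rpow_add hM0]; simp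
  -- The condition `p ≤ 1` enters here: it makes the exponent `r = 1` admissible.
  have hS1 : ∑ i ∈ S, |x i| ≤ s * M := by simpa using hSr 1 hp1
  have hTS : ‖T (coordRestrict S x)‖ ≤ 5 * β * (2 * (√s * M)) := by
    refine (norm_apply_coordRestrict_le hs T (by positivity) (fun W y hW => hup W y (by omega))
      x S M hM0.le fun i hi => (h1 i hi).trans hμM).trans ?_
    gcongr
    have : (√s)⁻¹ * ∑ i ∈ S, |x i| ≤ √s * M := by
      rw [inv_mul_eq_div, div_le_iff₀ hsq]
      calc ∑ i ∈ S, |x i| ≤ s * M := hS1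
        _ = (√s * √s) * M := by rw [Real.mul_self_sqrt hs0.le]
        _ = _ := by ring
    linarith
  set H := Sᶜ with hH
  have hHc : H.card ≤ 2 * s := by
    have hsub : H ⊆ (Finset.univ.filter fun i : Fin m => i.val < s) ∪ U := by
      intro i hi
      simp only [hH, hS, hR, Finset.mem_compl, Finset.mem_sdiff, Finset.mem_filter,
        Finset.mem_univ, true_and, Finset.mem_union] at hi ⊢
      by_cases hiU : i ∈ U
      · exact Or.inr hiU
      · left; by_contra hcon; exact hi ⟨by omega, hiU⟩
    have hcard : (Finset.univ.filter fun i : Fin m => i.val < s).card ≤ s := by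
      calc _ = ((Finset.univ.filter fun i : Fin m => i.val < s).image Fin.val).card :=
            (Finset.card_image_of_injective _ Fin.val_injective).symm
        _ ≤ (Finset.range s).card := by
            refine Finset.card_le_card fun j hj => ?_
            simp only [Finset.mem_image, Finset.mem_filter, Finset.mem_univ, true_and] at hj
            obtain ⟨i, hi, rfl⟩ := hj
            exact Finset.mem_range.2 hi
        _ = s := Finset.card_range s
    have := (Finset.card_le_card hsub).trans (Finset.card_union_le _ _)
    omega
  have hsum : T (coordRestrict H x) = -T (coordRestrict S x) := by
    rw [eq_neg_iff_add_eq_zero, ← map_add,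
      ← coordRestrict_union (disjoint_compl_left : Disjoint Sᶜ S), ← Finset.sup_eq_union,
      compl_sup_eq_top]
    convert hTx using 2
    ext i; simp [coordRestrict]
  -- The lower bound `β/8` on the head against the upper bound `10β√s M` on the tail gives the
  -- factor 80.
  set A : ℝ := 80 * M with hA
  have hA0 : 0 < A := by positivity
  have hHn : ‖coordRestrict H x‖ ≤ √s * A := by
    have h4 := hlow H x hHc
    rw [hsum, norm_neg] at h4
    have h5 : β * ‖coordRestrict H x‖ ≤ β * (√s * A) := by
      rw [hA]; linarith
    exact le_of_mul_le_mul_left h5 hβ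
  have hH2 : ∑ i ∈ H, x i ^ 2 ≤ s * A ^ 2 := by
    rw [← norm_sq_coordRestrict]
    calc ‖coordRestrict H x‖ ^ 2 ≤ (√s * A) ^ 2 := by gcongr
      _ = s * A ^ 2 := by rw [mul_pow, Real.sq_sqrt hs0.le]
  have hHq : ∑ i ∈ H, |x i| ^ q ≤ 3 * (s * A ^ q) := by
    calc ∑ i ∈ H, |x i| ^ q ≤ ∑ i ∈ H, (A ^ q + A ^ (q - 2) * x i ^ 2) := by
          refine Finset.sum_le_sum fun i _ => ?_
          rw [← sq_abs]
          exact rpow_le_of_sq hq0.le hq2 hA0 (abs_nonneg _)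
      _ = H.card * A ^ q + A ^ (q - 2) * ∑ i ∈ H, x i ^ 2 := by
          rw [Finset.sum_add_distrib, Finset.sum_const, nsmul_eq_mul, Finset.mul_sum]
      _ ≤ ((2 * s : ℕ) : ℝ) * A ^ q + A ^ (q - 2) * (s * A ^ 2) := by gcongr
      _ = 2 * (s * A ^ q) + s * (A ^ (q - 2) * A ^ (2 : ℝ)) := by
          push_cast; rw [Real.rpow_two]; ring
      _ = 3 * (s * A ^ q) := by rw [← Real.rpow_add hA0, sub_add_cancel]; ring
  have hSq : ∑ i ∈ S, |x i| ^ q ≤ s * A ^ q := by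
    refine (hSr q hpq.le).trans ?_
    gcongr
    rw [hA]; linarith
  have htot : ∑ i, |x i| ^ q ≤ 4 * (s * A ^ q) := by
    rw [← Finset.sum_compl_add_sum S]; linarith
  unfold EllipsoidSections.lqNorm
  calc (∑ i, |x i| ^ q) ^ (1 / q) ≤ (4 * (s * A ^ q)) ^ (1 / q) := by gcongr
    _ = 4 ^ (1 / q) * ((s : ℝ) ^ (1 / q) * A) := by
        rw [Real.mul_rpow (by norm_num) (by positivity), Real.mul_rpow hs0.le (by positivity),
          ← Real.rpow_mul hA0.le, mul_one_div_cancel hq0.ne', Real.rpow_one]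
    _ = 4 ^ (1 / q) * 80 * ((s : ℝ) ^ (1 / q) * M) := by rw [hA]; ring
    _ = _ := by
        rw [hM, ← Real.rpow_add hs0]; congr 2; ring

end

/-! ### Union bound over integer points -/

/-- The matrices that distort the Euclidean norm of the integer points in a ball of squared radius
`N` by a bounded factor only. -/
def wellConditionedOn (n m N : ℕ) : Set (Fin n → Fin m → ℝ) :=
  {A | ∀ z ∈ latticeBall m N, (n : ℝ) / 16 * ∑ j, (z j : ℝ) ^ 2 ≤ ∑ i, (∑ j, A i j * z j) ^ 2 ∧
    ∑ i, (∑ j, A i j * z j) ^ 2 ≤ 16 * (n : ℝ) * ∑ j, (z j : ℝ) ^ 2}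

theorem gaussianMatrix_wellConditionedOn {m n N : ℕ} (hn : 1 ≤ n) (hnm : n < m)
    (hN : (N : ℝ) * Real.log (Real.exp 1 * m / n) ≤ n / 64) :
    1 - 2 * Real.exp (-(1 / 4) * n) ≤
      (EllipsoidSections.gaussianMatrix n m).real (wellConditionedOn n m N) := by
  set P := EllipsoidSections.gaussianMatrix n m
  have h1 : (wellConditionedOn n m N)ᶜ ⊆ ⋃ z ∈ latticeBall m N,
      {A : Fin n → Fin m → ℝ | ¬ ((n : ℝ) / 16 * ∑ j, (z j : ℝ) ^ 2 ≤ ∑ i, (∑ j, A i j * z j) ^ 2 ∧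
        ∑ i, (∑ j, A i j * z j) ^ 2 ≤ 16 * (n : ℝ) * ∑ j, (z j : ℝ) ^ 2)} := by
    intro A hA
    simp only [wellConditionedOn, Set.mem_compl_iff, Set.mem_ofPred_eq, not_forall] at hA
    obtain ⟨z, hz, h⟩ := hA
    exact Set.mem_biUnion (Finset.mem_coe.2 hz) h
  have h2 : P.real (wellConditionedOn n m N)ᶜ ≤ 2 * Real.exp (-(1 / 4) * n) := by
    calc P.real (wellConditionedOn n m N)ᶜ ≤ _ := measureReal_mono h1 (measure_ne_top _ _)
      _ ≤ _ := measureReal_biUnion_finset_le _ _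
      _ ≤ ∑ _z ∈ latticeBall m N, 2 * Real.exp (-(n / 2)) :=
          Finset.sum_le_sum fun z _ => gaussianMatrix_distortion fun j => (z j : ℝ)
      _ = (latticeBall m N).card * (2 * Real.exp (-(n / 2))) := by
          rw [Finset.sum_const, nsmul_eq_mul]
      _ ≤ Real.exp (n / 4) * (2 * Real.exp (-(n / 2))) := by
          gcongr; exact card_latticeBall_le_exp hn hnm hN
      _ = 2 * (Real.exp (n / 4) * Real.exp (-(n / 2))) := by ring
      _ = 2 * Real.exp (-(1 / 4) * n) := by rw [← Real.exp_add]; congr 2; ring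
  -- Subadditivity suffices, so the measurability of the event plays no role.
  have h3 : (1 : ℝ) ≤ P.real (wellConditionedOn n m N) + P.real (wellConditionedOn n m N)ᶜ := by
    have := measureReal_union_le (μ := P) (wellConditionedOn n m N) (wellConditionedOn n m N)ᶜ
    rwa [Set.union_compl_self, probReal_univ] at this
  linarith

theorem norm_sq_toLpLin {n m : ℕ} (A : Fin n → Fin m → ℝ) (x : Fin m → ℝ) :
    ‖Matrix.toLpLin 2 2 (Matrix.of A) (WithLp.toLp 2 x)‖ ^ 2 = ∑ i, (∑ j, A i j * x j) ^ 2 := by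
  rw [EuclideanSpace.real_norm_sq_eq]
  simp [Matrix.toLpLin_apply, Matrix.mulVec, dotProduct]

theorem lqNorm_le_of_wellConditionedOn {p q lam : ℝ} (hp0 : 0 < p) (hp1 : p ≤ 1) (hpq : p < q)
    (hq2 : q ≤ 2) (hlam : 0 < lam) {n m s : ℕ} (hn : 1 ≤ n) (hs : 1 ≤ s)
    {A : Fin n → Fin m → ℝ} (hA : A ∈ wellConditionedOn n m (4096 * (2 * s)))
    {x : Fin m → ℝ}
    (hx : x ∈ EllipsoidSections.lpEllipsoid p (EllipsoidSections.polySemiaxes m lam))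
    (hAx : x ∈ EllipsoidSections.matrixKernel (Matrix.of A)) :
    EllipsoidSections.lqNorm q x ≤
      4 ^ (1 / q) * 80 * (s : ℝ) ^ (-(lam + 1 / p - 1 / q)) := by
  have hn0 : (0 : ℝ) < n := by exact_mod_cast hn
  have hβ : 0 < √(n : ℝ) := Real.sqrt_pos.2 hn0
  have hβ2 : √(n : ℝ) ^ 2 = n := Real.sq_sqrt hn0.le
  let T : EuclideanSpace ℝ (Fin m) →L[ℝ] EuclideanSpace ℝ (Fin n) :=
    LinearMap.toContinuousLinearMap (Matrix.toLpLin 2 2 (Matrix.of A))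
  have hT2 : ∀ y : Fin m → ℝ, ‖T (WithLp.toLp 2 y)‖ ^ 2 = ∑ i, (∑ j, A i j * y j) ^ 2 :=
    norm_sq_toLpLin A
  have hk : 1 ≤ 2 * s := by omega
  have hup : ∀ z ∈ latticeBall m (4096 * (2 * s)), ‖T (WithLp.toLp 2 (fun i => (z i : ℝ)))‖ ≤
      4 * √(n : ℝ) * ‖(WithLp.toLp 2 (fun i => (z i : ℝ)) : EuclideanSpace ℝ (Fin m))‖ := by
    intro z hz
    rw [← sq_le_sq₀ (norm_nonneg _) (by positivity), hT2, mul_pow, mul_pow, hβ2,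
      EuclideanSpace.real_norm_sq_eq]
    have := (hA z hz).2
    norm_num
    linarith
  have hlow : ∀ z ∈ latticeBall m (4096 * (2 * s)),
      √(n : ℝ) / 4 * ‖(WithLp.toLp 2 (fun i => (z i : ℝ)) : EuclideanSpace ℝ (Fin m))‖ ≤
      ‖T (WithLp.toLp 2 (fun i => (z i : ℝ)))‖ := by
    intro z hz
    rw [← sq_le_sq₀ (by positivity) (norm_nonneg _), hT2, mul_pow, div_pow, hβ2,
      EuclideanSpace.real_norm_sq_eq]
    have := (hA z hz).1
    norm_num
    linarith
  have hsupp : ∀ (U : Finset (Fin m)) (y : Fin m → ℝ), ∀ i ∉ U, coordRestrict U y i = 0 := by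
    intro U y i hi
    simp [coordRestrict, hi]
  refine lqNorm_le_of_sparse_bounds hp0 hp1 hpq hq2 hlam hs T hβ
    (fun U y hU => sparse_upper_of_lattice hk T hβ.le hup hU (hsupp U y))
    (fun U y hU => sparse_lower_of_lattice hk T hβ.le hup hlow hU (hsupp U y)) hx ?_
  have h0 : (Matrix.of A).mulVec x = 0 := by
    rw [EllipsoidSections.matrixKernel, LinearMap.mem_ker, Matrix.toLin'_apply] at hAx
    exact hAx
  change Matrix.toLpLin 2 2 (Matrix.of A) (WithLp.toLp 2 x) = 0
  rw [Matrix.toLpLin_apply, h0]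
  rfl

/-! ### Gelfand numbers and choice of constants -/

/-- A kernel may have codimension below `n`, whereas the Gelfand number asks for codimension exactly
`n`; shrinking the subspace only lowers the supremum. -/
theorem exists_submodule_le_finrank_eq {K W : Type*} [DivisionRing K] [AddCommGroup W] [Module K W]
    (F : Submodule K W) {d : ℕ} (hd : d ≤ Module.finrank K F) :
    ∃ E ≤ F, Module.finrank K E = d := by
  obtain ⟨f, hf⟩ := exists_linearIndependent_of_le_finrank hd
  refine ⟨Submodule.span K (Set.range fun i => (f i : W)), ?_, ?_⟩
  · rw [Submodule.span_le]
    rintro _ ⟨i, rfl⟩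
    exact (f i).2
  · rw [finrank_span_eq_card (b := fun i => (f i : W))
      (hf.map' F.subtype (Submodule.ker_subtype F)), Fintype.card_fin]

theorem diagOp_mem_lpEllipsoid {m : ℕ} {p : ℝ} (hp : 0 < p) {σ : Fin m → ℝ} (hσ : ∀ i, 0 < σ i)
    {x : Fin m → ℝ} (hx : x ∈ EllipsoidSections.lpBall m p) :
    EllipsoidSections.diagOp σ x ∈ EllipsoidSections.lpEllipsoid p σ := by
  have h1 : ∑ i, |x i| ^ p ≤ 1 := by
    have hx' : (∑ i, |x i| ^ p) ^ (1 / p) ≤ 1 := hx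
    by_contra! hcon
    exact absurd (Real.one_lt_rpow hcon (by positivity : 0 < 1 / p)) (not_lt.2 hx')
  change ∑ i, |EllipsoidSections.diagOp σ x i| ^ p / σ i ^ p ≤ 1
  refine le_trans (le_of_eq (Finset.sum_congr rfl fun i _ => ?_)) h1
  rw [EllipsoidSections.diagOp, Matrix.toLin'_apply, Matrix.mulVec_diagonal, abs_mul,
    abs_of_pos (hσ i), Real.mul_rpow (hσ i).le (abs_nonneg _),
    mul_div_cancel_left₀ _ (Real.rpow_pos_of_pos (hσ i) p).ne']

/-- The radius of a section with the kernel of an `n × m` matrix bounds a Gelfand number. -/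
theorem gelfandNumber_diagOp_le_sectionRadius {n m : ℕ} (hnm : n < m) {p q : ℝ} (hp : 0 < p)
    {σ : Fin m → ℝ} (hσ : ∀ i, 0 < σ i) (A : Matrix (Fin n) (Fin m) ℝ) :
    EllipsoidSections.gelfandNumber (n + 1) p q (EllipsoidSections.diagOp σ) ≤
      EllipsoidSections.sectionRadius q (EllipsoidSections.lpEllipsoid p σ)
        (EllipsoidSections.matrixKernel A) := by
  set F : Submodule ℝ (Fin m → ℝ) :=
    LinearMap.ker (Matrix.toLin' A ∘ₗ EllipsoidSections.diagOp σ) with hF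
  have hdim : m - n ≤ Module.finrank ℝ F := by
    have h1 := LinearMap.finrank_range_add_finrank_ker
      (Matrix.toLin' A ∘ₗ EllipsoidSections.diagOp σ)
    have h2 := Submodule.finrank_le
      (LinearMap.range (Matrix.toLin' A ∘ₗ EllipsoidSections.diagOp σ))
    rw [Module.finrank_fin_fun] at h1 h2
    rw [hF]
    omega
  obtain ⟨E, hEF, hE⟩ := exists_submodule_le_finrank_eq F hdim
  have hq := Submodule.finrank_quotient_add_finrank E
  rw [Module.finrank_fin_fun, hE] at hq
  rw [EllipsoidSections.gelfandNumber, if_neg (by omega)]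
  refine (iInf₂_le E (by omega)).trans ?_
  refine iSup₂_le fun x hx => ?_
  refine le_iSup₂_of_le (EllipsoidSections.diagOp σ x)
    ⟨diagOp_mem_lpEllipsoid hp hσ hx.1, ?_⟩ le_rfl
  exact hEF hx.2

theorem mainTheorem6 (p q lam : ℝ) (hp0 : 0 < p) (hp1 : p ≤ 1) (hpq : p < q) (hq2 : q ≤ 2)
    (hlam : 0 < lam) :
    ∃ c C D : ℝ, 0 < c ∧ 0 < C ∧ 0 < D ∧
      ∀ m n : ℕ, 1 ≤ n → n < m → D * Real.log (Real.exp 1 * m / n) ≤ n →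
        1 - 2 * Real.exp (-c * n) ≤
            (EllipsoidSections.gaussianMatrix n m).real
              {A | EllipsoidSections.sectionRadius q
                    (EllipsoidSections.lpEllipsoid p (EllipsoidSections.polySemiaxes m lam))
                    (EllipsoidSections.matrixKernel (Matrix.of A)) ≤
                  ENNReal.ofReal
                    (C * (Real.log (Real.exp 1 * m / n) / n) ^ (lam + 1 / p - 1 / q))} ∧
          EllipsoidSections.gelfandNumber (n + 1) p q
              (EllipsoidSections.diagOp (EllipsoidSections.polySemiaxes m lam)) ≤
            ENNReal.ofReal
              (C * (Real.log (Real.exp 1 * m / n) / n) ^ (lam + 1 / p - 1 / q)) := by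
  have hq0 : 0 < q := hp0.trans hpq
  have hα : 0 < lam + 1 / p - 1 / q := by
    have : 1 / q < 1 / p := one_div_lt_one_div_of_lt hp0 hpq
    linarith
  set α := lam + 1 / p - 1 / q with hαdef
  -- `2^19 = 64 * 8192` makes the lattice radius `8192 s` meet the counting condition; `D = 2^19`
  -- ensures `s ≥ 1`, so the floor loses at most a factor 2, whence `2^20`.
  refine ⟨1 / 4, 4 ^ (1 / q) * 80 * (2 ^ 20) ^ α, 2 ^ 19, by norm_num, by positivity, by norm_num,
    ?_⟩
  intro m n hn hnm hD
  have hn0 : (0 : ℝ) < n := by exact_mod_cast hn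
  have hnm' : (n : ℝ) < m := by exact_mod_cast hnm
  set l := Real.log (Real.exp 1 * m / n) with hl
  have hl1 : 1 ≤ l := by
    rw [hl, Real.le_log_iff_exp_le (by have := hn0.trans hnm'; positivity), le_div_iff₀ hn0]
    gcongr
  have hl0 : 0 < l := by linarith
  have hr1 : 1 ≤ n / (2 ^ 19 * l) := by rw [le_div_iff₀ (by positivity)]; linarith
  set s := ⌊n / (2 ^ 19 * l)⌋₊ with hsdef
  have hs : 1 ≤ s := Nat.le_floor (by exact_mod_cast hr1)
  have hs0 : (0 : ℝ) < s := by exact_mod_cast hs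
  have hsup : s * (2 ^ 19 * l) ≤ n := by
    rw [← le_div_iff₀ (by positivity)]; exact Nat.floor_le (by positivity)
  have hslow : n / (2 ^ 20 * l) ≤ s := by
    have h1 := Nat.lt_floor_add_one (n / (2 ^ 19 * l))
    have h2 : (1 : ℝ) ≤ s := by exact_mod_cast hs
    have h3 : n / (2 ^ 20 * l) = n / (2 ^ 19 * l) / 2 := by field_simp
    rw [← hsdef] at h1
    rw [h3]; linarith
  have hN : ((4096 * (2 * s) : ℕ) : ℝ) * l ≤ n / 64 := by push_cast; linarith
  have hprob := gaussianMatrix_wellConditionedOn hn hnm hN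
  have hbound : 4 ^ (1 / q) * 80 * (s : ℝ) ^ (-α) ≤
      4 ^ (1 / q) * 80 * (2 ^ 20) ^ α * (l / n) ^ α := by
    rw [mul_assoc _ (_ ^ α) (_ ^ α), ← Real.mul_rpow (by positivity) (by positivity),
      Real.rpow_neg hs0.le, ← Real.inv_rpow hs0.le]
    gcongr
    rw [inv_le_comm₀ hs0 (by positivity)]
    refine le_trans (le_of_eq ?_) hslow
    field_simp
  have hrad : ∀ A ∈ wellConditionedOn n m (4096 * (2 * s)),
      EllipsoidSections.sectionRadius q
        (EllipsoidSections.lpEllipsoid p (EllipsoidSections.polySemiaxes m lam))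
        (EllipsoidSections.matrixKernel (Matrix.of A)) ≤
      ENNReal.ofReal (4 ^ (1 / q) * 80 * (2 ^ 20) ^ α * (l / n) ^ α) := fun A hA =>
    iSup₂_le fun x hx => ENNReal.ofReal_le_ofReal
      ((lqNorm_le_of_wellConditionedOn hp0 hp1 hpq hq2 hlam hn hs hA hx.1 hx.2).trans hbound)
  constructor
  · exact hprob.trans (measureReal_mono hrad)
  · have hpos : 0 < (EllipsoidSections.gaussianMatrix n m).real
        (wellConditionedOn n m (4096 * (2 * s))) := by
      refine lt_of_lt_of_le ?_ hprob
      -- The assumption on `D` forces `n ≥ 2^19`, so a good matrix exists with positive probability.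
      have h1 : 2 < Real.exp (1 / 4 * n) := by
        have := Real.add_one_le_exp (1 / 4 * (n : ℝ))
        linarith
      rw [neg_mul, Real.exp_neg, sub_pos, ← div_eq_mul_inv, div_lt_one (Real.exp_pos _)]
      exact h1
    obtain ⟨A, hA⟩ : (wellConditionedOn n m (4096 * (2 * s))).Nonempty := by
      by_contra hcon
      rw [Set.not_nonempty_iff_eq_empty.1 hcon, measureReal_empty] at hpos
      exact lt_irrefl _ hpos
    refine (gelfandNumber_diagOp_le_sectionRadius hnm hp0 (fun i => ?_) (Matrix.of A)).trans
      (hrad A hA)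
    unfold EllipsoidSections.polySemiaxes
    positivity
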